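/- **Setting.** Let $\mathcal T$ be a finite set of tasks with strictly positive prior $\pi$. For $t\in\mathcal T$ let $p(x\mid t)$ be the density (with respect to a $\sigma$-finite measure) of the input $x$, $p(y\mid x,t)$ the probability mass function of the output $y$ on a countable set, $p(x,y\mid t)=p(x\mid t)\,p(y\mid x,t)$ with law $P_{x,y\mid t}$, and $p(i\mid t)$ the density of an instruction $i\in\mathbb R^d$. Assume * (identifiability) $\mathrm{KL}(P_{x,y\mid s}\,\|\,P_{x,y\mid t})>0$ for all $s\ne t$; * (bounded instruction sensitivity) $p(i\mid t)>0$, $\log p(i\mid t)$ is differentiable in $i$, and $\|\nabla_i\log p(i\mid t)\|\le G$ for all $i,t$, where $G>0$ is a constant. Fix the true task $t^*$, a query $x_{\rm query}$ with $p(x_{\rm query}\mid t^*)>0$, an output $y_{\rm query}$, an instruction $i^*\in\mathbb R^d$ and radii $0<r<R$. Let $(x_1,y_1),(x_2,y_2),\dots$ be i.i.d. with law $P_{x,y\mid t^*}$. In a prompt with $N$ demonstrations, each demonstration carries its own instruction (format 6); put $k=Nd$, write $I=(i_1,\dots,i_N)\in\mathbb R^k$ (Euclidean norm), $p(I\mid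 t)=\prod_{j\le N}p(i_j\mid t)$, and $$f(I)=\sum_{t}p(y_{\rm query}\mid x_{\rm query},t)\,\frac{w_t(I)}{\sum_s w_s(I)},\qquad w_t(I)=\pi(t)\,p(I\mid t)\,p(x_{\rm query}\mid t)\prod_{j\le N}p(x_j,y_j\mid t).$$ Let $I^{\rm in}=(i^*,\dots,i^*)\in\mathbb R^k$, let $D_{0}$ and $D$ be the closed balls of radii $r$ and $R$ around $I^{\rm in}$, and set $C_1=\log(2R/r)$, $$A_t(I)=\frac{\pi(t)}{\pi(t^*)}\cdot\frac{p(I\mid t)}{p(I\mid t^*)}\cdot\frac{p(x_{\rm query}\mid t)}{p(x_{\rm query}\mid t^*)},\quad A_{\max}(N)=\max_{t\ne t^*}\sup_{I\in D_0}A_t(I),\quad \beta(N)=(|\mathcal T|-1)A_{\max}(N)$$ (with $A_{\max}(N)=0$ if $t^*$ is the only task). For $n\ge 1$ and reals $\varepsilon_n,\delta_n$, a *$C^1$ surrogate* is a polynomial $p_n$ on $\mathbb R^k$ of total degree at most $nk$ with $|f-p_n|\le\varepsilon_n$ and $\|\nabla f-\nabla p_n\|\le\delta_n$ on $D$. Write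 $$\mathcal B_{N,n}(\varepsilon_n,\delta_n)=\frac{2n^2k^2}{R}\,e^{C_1kn}\bigl(\beta(N)e^{-\alpha N}+\varepsilon_n\bigr)+\delta_n .$$ **Corollary.** The suprema defining $A_{\max}(N)$ are finite, and there is a constant $\alpha>0$ such that the following hold. 1. Almost surely there is $N_0$ such that for all $N\ge N_0$, all $n\ge1$ and all $\varepsilon_n,\delta_n$ for which a $C^1$ surrogate exists, $f$ is differentiable at every point of $D$ and $$\sup_{I\in D}\|\nabla f(I)\|\le \frac{2n^2k^2}{R}\,e^{C_1kn}\bigl(\beta(N)e^{-\alpha N}+\varepsilon_n\bigr)+\delta_n=\mathcal B_{N,n}(\varepsilon_n,\delta_n).$$ 2. Suppose moreover that $i^*$ is correct for $t^*$, i.e. $p(i^*\mid t^*)>p(i^*\mid t)$ for all $t\ne t^*$. Then $A_{\max}(N)=O(e^{2G\sqrt N r})$. Further, for all $c_0>0$ and $0<c_1\le c_2$ there are constants $\alpha',\beta',\varepsilon'>0$ such that almost surely there is $N_0$ such that for all $N\ge N_0$ and all $n$ with $c_1G^2R^2dN^2\le n\le c_2G^2R^2dN^2$ (that is, $n=\Theta(G^2R^2dN^2)$),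 with $L:=\sqrt{C_1kn}$: * $\sqrt{C_1c_1}\,GRdN^{3/2}\le L\le\sqrt{C_1c_2}\,GRdN^{3/2}$; * for all $\delta_n$ and all $\varepsilon_n\le c_0GR\sqrt d\,N/\sqrt n$, $$\mathcal B_{N,n}(\varepsilon_n,\delta_n)\le\frac{2}{RC_1^2}\,L^4e^{L^2}\bigl(\beta'e^{-\alpha'N}+\varepsilon'\bigr)+\delta_n;$$ * $f$ is differentiable at every point of $D$ and $$\sup_{I\in D}\|\nabla f(I)\|\le\frac{2}{RC_1^2}\,L^4e^{L^2}\bigl(\beta'e^{-\alpha'N}+\varepsilon'\bigr).$$ -/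

import Mathlib

open MeasureTheory ProbabilityTheory

/-- A latent task model: a finite set `T` of tasks with a strictly positive prior, and, for each task,
a density of the input `x`, a probability mass function of the output `y` given `x`,
and a density of an instruction, embedded in `d`-dimensional Euclidean space.
Densities are taken with respect to arbitrary reference measures `refX`, `refI`. -/
structure LatentTaskModel (T X Y : Type*) [Fintype T] [MeasurableSpace X] [MeasurableSpace Y]
    (d : ℕ) where
  /-- the prior `π(t)` -/
  prior : T → ℝ
  prior_pos : ∀ t, 0 < prior t
  prior_sum : ∑ t, prior t = 1
  /-- reference measure on inputs -/
  refX : Measure X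
  refX_sigmaFinite : SigmaFinite refX
  /-- the density `p(x | t)` -/
  pX : T → X → ℝ
  pX_nonneg : ∀ t x, 0 ≤ pX t x
  pX_measurable : ∀ t, Measurable (pX t)
  pX_lintegral : ∀ t, ∫⁻ x, ENNReal.ofReal (pX t x) ∂refX = 1
  /-- the probability mass `p(y | x, t)` -/
  pY : T → X → Y → ℝ
  pY_nonneg : ∀ t x y, 0 ≤ pY t x y
  pY_measurable : ∀ t, Measurable (fun q : X × Y => pY t q.1 q.2)
  pY_hasSum : ∀ t x, HasSum (pY t x) 1
  /-- reference measure on instructions -/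
  refI : Measure (EuclideanSpace ℝ (Fin d))
  /-- the density `p(i | t)` of a single instruction -/
  pI : T → EuclideanSpace ℝ (Fin d) → ℝ
  pI_nonneg : ∀ t i, 0 ≤ pI t i
  pI_measurable : ∀ t, Measurable (pI t)
  pI_lintegral : ∀ t, ∫⁻ i, ENNReal.ofReal (pI t i) ∂refI = 1

/-- The space `ℝ^k`, `k = N d`, of instruction sequences of length `N` (Euclidean norm). -/
abbrev InstrSeq (N d : ℕ) : Type := EuclideanSpace ℝ (Fin N × Fin d)

/-- The `j`-th instruction of an instruction sequence. -/
noncomputable def InstrSeq.block {N d : ℕ} (I : InstrSeq N d) (j : Fin N) :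
    EuclideanSpace ℝ (Fin d) :=
  WithLp.toLp 2 (fun a => I (j, a))

/-- The constant instruction sequence `(i, …, i)`. -/
noncomputable def InstrSeq.const (N : ℕ) {d : ℕ} (i : EuclideanSpace ℝ (Fin d)) : InstrSeq N d :=
  WithLp.toLp 2 (fun q => i q.2)

/-- `p` is a polynomial of total degree at most `m` with `‖f - p‖_∞ ≤ ε` and `‖∇f - ∇p‖_∞ ≤ δ`
on `D`. -/
def IsC1Surrogate {ι : Type*} [Fintype ι] (f : EuclideanSpace ℝ ι → ℝ)
    (D : Set (EuclideanSpace ℝ ι)) (m : ℕ) (ε δ : ℝ) (p : MvPolynomial ι ℝ) : Prop :=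
  p.totalDegree ≤ m ∧
  (∀ I ∈ D, |f I - MvPolynomial.eval (fun a => I a) p| ≤ ε) ∧
  (∀ I ∈ D, ‖gradient f I -
    gradient (fun J : EuclideanSpace ℝ ι => MvPolynomial.eval (fun a => J a) p) I‖ ≤ δ)

/-- The explicit bound `(2 n² k² / R) exp(C₁ k n) (b + ε) + δ`, with `C₁ = log (2 R / r)`. -/
noncomputable def explicitBound (r R : ℝ) (n k : ℕ) (b ε δ : ℝ) : ℝ :=
  2 * (n : ℝ) ^ 2 * (k : ℝ) ^ 2 / R * Real.exp (Real.log (2 * R / r) * k * n) * (b + ε) + δ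

namespace LatentTaskModel

variable {T X Y : Type*} [Fintype T] [MeasurableSpace X] [MeasurableSpace Y] {d : ℕ}

/-- The joint density `p(x, y | t) = p(x | t) p(y | x, t)`. -/
noncomputable def pXY (M : LatentTaskModel T X Y d) (t : T) (q : X × Y) : ℝ :=
  M.pX t q.1 * M.pY t q.1 q.2

/-- The joint law `P_{x, y | t}` of an input-output pair under task `t`. -/
noncomputable def jointLaw (M : LatentTaskModel T X Y d) (t : T) : Measure (X × Y) :=
  (M.refX.prod Measure.count).withDensity (fun q => ENNReal.ofReal (M.pXY t q))

/-- Distinct tasks are distinguishable: `KL(P_{x,y|s} ‖ P_{x,y|t}) > 0` whenever `s ≠ t`. -/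
def Identifiable (M : LatentTaskModel T X Y d) : Prop :=
  ∀ s t : T, s ≠ t → 0 < InformationTheory.klDiv (M.jointLaw s) (M.jointLaw t)

/-- Bounded instruction sensitivity: `log p(i | t)` is well defined and differentiable in `i`, and
`‖∇_i log p(i | t)‖ ≤ G`, for all `t` and `i`. -/
def BoundedInstruction (M : LatentTaskModel T X Y d) (G : ℝ) : Prop :=
  ∀ t i, 0 < M.pI t i ∧ DifferentiableAt ℝ (fun j => Real.log (M.pI t j)) i ∧
    ‖gradient (fun j => Real.log (M.pI t j)) i‖ ≤ G

/-- The instruction `i` is correct for the task `tstar`. -/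
def CorrectInstruction (M : LatentTaskModel T X Y d) (tstar : T)
    (i : EuclideanSpace ℝ (Fin d)) : Prop :=
  ∀ t, t ≠ tstar → M.pI t i < M.pI tstar i

/-- Likelihood of an instruction sequence: `p(I | t) = ∏ⱼ p(iⱼ | t)`. -/
noncomputable def pSeq (M : LatentTaskModel T X Y d) {N : ℕ} (t : T) (I : InstrSeq N d) : ℝ :=
  ∏ j : Fin N, M.pI t (I.block j)

/-- The unnormalized posterior `π(t) p(I | t) p(x_query | t) ∏ⱼ p(xⱼ, yⱼ | t)` of task `t` given a
prompt in which each of the first `N` demonstrations of `z` carries its own instruction. -/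
noncomputable def weight (M : LatentTaskModel T X Y d) (z : ℕ → X × Y) (xq : X) {N : ℕ} (t : T)
    (I : InstrSeq N d) : ℝ :=
  M.prior t * M.pSeq t I * M.pX t xq * ∏ j : Fin N, M.pXY t (z j)

/-- The posterior `p(t | z(I))` over tasks. -/
noncomputable def posterior (M : LatentTaskModel T X Y d) (z : ℕ → X × Y) (xq : X) {N : ℕ} (t : T)
    (I : InstrSeq N d) : ℝ :=
  M.weight z xq t I / ∑ s, M.weight z xq s I

/-- The posterior predictive `f(I) = p(y_query | z(I)) = ∑ₜ p(y_query | x_query, t) p(t | z(I))`. -/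
noncomputable def predictive (M : LatentTaskModel T X Y d) (z : ℕ → X × Y) (xq : X) (yq : Y)
    (N : ℕ) (I : InstrSeq N d) : ℝ :=
  ∑ t, M.pY t xq yq * M.posterior z xq t I

/-- The non-demonstration ratio
`A_t(I) = (π(t)/π(t*)) (p(I | t)/p(I | t*)) (p(x_query | t)/p(x_query | t*))`. -/
noncomputable def ratioA (M : LatentTaskModel T X Y d) (tstar : T) (xq : X) {N : ℕ} (t : T)
    (I : InstrSeq N d) : ℝ :=
  M.prior t / M.prior tstar * (M.pSeq t I / M.pSeq tstar I) * (M.pX t xq / M.pX tstar xq)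

/-- `A_max(N)`, the maximum over the wrong tasks `t` of `sup A_t` on the ball of radius `r` around
`(i, …, i)`; it is `0` if there is no wrong task. -/
noncomputable def Amax (M : LatentTaskModel T X Y d) (tstar : T) (xq : X)
    (i : EuclideanSpace ℝ (Fin d)) (r : ℝ) (N : ℕ) : ℝ :=
  ⨆ t : {t : T // t ≠ tstar}, ⨆ I : Metric.closedBall (InstrSeq.const N i) r,
    M.ratioA tstar xq t.1 I.1

/-- `β(N) = (|T| - 1) A_max(N)`. -/
noncomputable def beta (M : LatentTaskModel T X Y d) (tstar : T) (xq : X)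
    (i : EuclideanSpace ℝ (Fin d)) (r : ℝ) (N : ℕ) : ℝ :=
  ((Fintype.card T : ℝ) - 1) * M.Amax tstar xq i r N

end LatentTaskModel

/-!
Write `c = p(y_query | x_query, t*)` and `k = N d`.

*Concentration.* On the inner ball the posterior predictive `f` is within `β(N) exp (-α N)` of `c`.
Indeed `|f - c|` is at most the sum over the wrong tasks of `A_t(I)` times the likelihood ratio of the
demonstrations, and these ratios decay exponentially, almost surely
(`exists_eventually_prod_div_le_exp`): the expectation of the square root of one ratio is the
Hellinger affinity of two distinct laws, which is less than one, and a Borel–Cantelli argument does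
the rest. The suprema of `A_t` are finite because `log p(I | t)` is `G √N`-Lipschitz in `I`; when the
repeated instruction is correct, the ratios at the centre of the ball are bounded in `N`, which gives
`A_max(N) = O(exp (2 G √N r))`.

*Polynomial growth.* A surrogate `p` of degree `m = n k` is thus within `β(N) exp (-α N) + ε` of `c` on
the inner ball. Chebyshev's growth estimate outside an interval and Bernstein's inequality at the
midpoint of an interval, both consequences of the extremality of Chebyshev polynomials, give
`‖∇p‖ ≤ (2 m² / R) (2 R / r) ^ m (β(N) exp (-α N) + ε)` on the outer ball
(`MvPolynomial.norm_gradient_eval_le`), and `∇f` differs from `∇p` by at most `δ`.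

*The choice `n = Θ(G² R² d N²)`.* The factor in front of the bound equals `2 L⁴ exp (L²) / (R C₁²)`;
half of the exponential rate absorbs `exp (2 G √N r)`, and the surrogate error is at most
`ε' = c₀ / √c₁`. For the last estimate no surrogate is given. There the Lipschitz bound for `log f`
yields `‖∇f‖ ≤ 4 G √N` directly (`LatentTaskModel.norm_gradient_predictive_le`), which is eventually
below the right-hand side, as that is at least of order `N²`.
-/

/-! ### Chebyshev and Bernstein estimates in one variable -/

namespace Polynomial

open Polynomial.Chebyshev

/-- Beyond the interval `[-1, 1]`, the Chebyshev polynomial `T n` has the largest derivatives of every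
order among the polynomials of degree at most `n` with the same bound on `[-1, 1]`. This is the
scaled, two-sided form of `eval_iterate_derivative_le_of_forall_abs_le_one`. -/
theorem abs_eval_iterate_derivative_le {n k : ℕ} {P : ℝ[X]} {M x : ℝ} (hP : P.natDegree ≤ n)
    (hM : ∀ s ∈ Set.Icc (-1 : ℝ) 1, |P.eval s| ≤ M) (hx : 1 ≤ x) :
    |(derivative^[k] P).eval x| ≤ M * (derivative^[k] (T ℝ n)).eval x := by
  rcases (abs_nonneg _).trans (hM 0 (by norm_num)) |>.eq_or_lt with h0 | h0
  · have : P = 0 := by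
      refine eq_zero_of_infinite_isRoot P ((Set.Icc_infinite (by norm_num : (-1 : ℝ) < 1)).mono ?_)
      intro s hs
      simpa [← h0] using hM s hs
    simp [this, ← h0]
  · have key : ∀ c : ℝ, |c| = M⁻¹ →
        c * (derivative^[k] P).eval x ≤ (derivative^[k] (T ℝ n)).eval x := by
      intro c hc
      have := eval_iterate_derivative_le_of_forall_abs_le_one (P := C c * P) (n := n) (k := k) hx
        ?_ ?_
      · simpa [iterate_derivative_C_mul] using this
      · exact natDegree_le_iff_degree_le.mp ((natDegree_C_mul_le _ _).trans hP)
      · intro s hs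
        rw [eval_C_mul, abs_mul, hc, inv_mul_le_one₀ h0]
        exact hM s hs
    have h1 := key M⁻¹ (abs_of_pos (by positivity))
    have h2 := key (-M⁻¹) (by rw [abs_neg, abs_of_pos (by positivity)])
    rw [mul_comm M, ← div_le_iff₀ h0, ← abs_of_pos h0, ← abs_div, abs_le]
    constructor
    · rw [div_eq_inv_mul]; linarith
    · rw [div_eq_inv_mul]; linarith

/-- The factor `1 / 2` absorbs most of the loss that comes from enlarging the outer ball in
`MvPolynomial.norm_gradient_eval_le`. -/
theorem eval_T_le {n : ℕ} (hn : n ≠ 0) {x : ℝ} (hx : 1 ≤ x) :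
    (T ℝ n).eval x ≤ (2 * x) ^ n / 2 := by
  induction n with
  | zero => exact absurd rfl hn
  | succ n ih =>
    rcases n with _ | n
    · simp
    · have h := T_add_two ℝ n
      have h1 := one_le_eval_T_real n hx
      have h2 := ih (by simp)
      push_cast at h2 ⊢
      rw [show (n : ℤ) + 1 + 1 = n + 2 by ring, h]
      simp only [eval_sub, eval_mul, eval_ofNat, eval_X]
      rw [pow_succ (2 * x) (n + 1)]
      nlinarith

theorem abs_eval_le_of_one_le {n : ℕ} (hn : n ≠ 0) {P : ℝ[X]} {M x : ℝ} (hP : P.natDegree ≤ n)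
    (hM : ∀ s ∈ Set.Icc (-1 : ℝ) 1, |P.eval s| ≤ M) (hx : 1 ≤ x) :
    |P.eval x| ≤ (2 * x) ^ n / 2 * M := by
  have h := abs_eval_iterate_derivative_le (k := 0) hP hM hx
  have h0 := (abs_nonneg _).trans (hM 0 (by norm_num))
  rw [mul_comm]
  exact h.trans (mul_le_mul_of_nonneg_left (eval_T_le hn hx) h0)

/-- The splitting of a polynomial into its even part `A(x²)` and its odd part `x B(x²)`. -/
theorem eval_eq_contract_add (P : ℝ[X]) (x : ℝ) :
    P.eval x = (contract 2 P).eval (x ^ 2) + x * (contract 2 (divX P)).eval (x ^ 2) := by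
  have : P = expand ℝ 2 (contract 2 P) + X * expand ℝ 2 (contract 2 (divX P)) := by
    ext i
    rcases i with _ | i
    · simp [coeff_expand, coeff_contract]
    · rw [coeff_add, coeff_X_mul, coeff_expand two_pos, coeff_expand two_pos,
        coeff_contract two_ne_zero, coeff_contract two_ne_zero, coeff_divX]
      rcases Nat.even_or_odd i with h | h
      · have h1 : 2 ∣ i := h.two_dvd
        have h2 : ¬ 2 ∣ i + 1 := by omega
        rw [if_neg h2, if_pos h1, Nat.div_mul_cancel h1, zero_add]
      · have h1 : ¬ 2 ∣ i := by have := Nat.odd_iff.mp h; omega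
        have h2 : 2 ∣ i + 1 := by omega
        rw [if_pos h2, if_neg h1, Nat.div_mul_cancel h2, add_zero]
  conv_lhs => rw [this]
  simp [expand_eval]

/-- Bernstein's inequality at the centre of `[-1, 1]`: `|P'(0)| ≤ n M`. If `x B(x²)` is the odd part of
`P`, then `y B(y)²` is a polynomial of degree at most `n` in `y = x²` with values in `[0, M²]` on
`[0, 1]`. Its derivative at the end point `y = 0` is `B(0)² = P'(0)²`, and Markov's inequality at an
end point bounds it by `n² M²`. -/
theorem abs_coeff_one_le {n : ℕ} {P : ℝ[X]} {M : ℝ} (hP : P.natDegree ≤ n)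
    (hM : ∀ s ∈ Set.Icc (-1 : ℝ) 1, |P.eval s| ≤ M) : |P.coeff 1| ≤ n * M := by
  have h0 := (abs_nonneg _).trans (hM 0 (by norm_num))
  rcases Nat.eq_zero_or_pos n with rfl | hn
  · rw [coeff_eq_zero_of_natDegree_lt (by omega)]; simp
  set B := contract 2 (divX P) with hB
  have hBdeg : 2 * B.natDegree + 1 ≤ n := by
    have : B.natDegree ≤ (n - 1) / 2 := by
      rw [natDegree_le_iff_coeff_eq_zero]
      intro N hN
      rw [hB, coeff_contract two_ne_zero, coeff_divX]
      exact coeff_eq_zero_of_natDegree_lt (by omega)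
    omega
  have hBy : ∀ y ∈ Set.Icc (0 : ℝ) 1, y * B.eval y ^ 2 ≤ M ^ 2 := by
    intro y hy
    have hs : √y ^ 2 = y := Real.sq_sqrt hy.1
    have hs1 : √y ≤ 1 := Real.sqrt_le_one.mpr hy.2
    have hs0 := Real.sqrt_nonneg y
    have e1 := eval_eq_contract_add P (√y)
    have e2 := eval_eq_contract_add P (-√y)
    rw [neg_sq, hs] at e2
    rw [hs] at e1
    have a1 := abs_le.mp (hM (√y) ⟨by linarith, hs1⟩)
    have a2 := abs_le.mp (hM (-√y) ⟨by linarith, by linarith⟩)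
    have : (√y * B.eval y) ^ 2 ≤ M ^ 2 := by
      refine sq_le_sq' ?_ ?_ <;> rw [hB] <;> linarith
    rwa [mul_pow, hs] at this
  -- the substitution `y = (1 - z) / 2` moves the end point `y = 0` to `z = 1`, where `T n` is extremal
  let Q : ℝ[X] := C (M ^ 2) - C 2 * (X * B ^ 2).comp (C (1 / 2) - C (1 / 2) * X)
  have hQdeg : Q.natDegree ≤ n := by
    refine (natDegree_sub_le _ _).trans ?_
    rw [natDegree_C]
    refine max_le (Nat.zero_le _) ((natDegree_C_mul_le _ _).trans (natDegree_comp_le.trans ?_))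
    have h1 : (X * B ^ 2).natDegree ≤ n := by
      refine natDegree_mul_le.trans ?_
      have := natDegree_pow_le (p := B) (n := 2)
      rw [natDegree_X]; omega
    have h2 : (C (1 / 2 : ℝ) - C (1 / 2) * X).natDegree ≤ 1 := by
      compute_degree
    calc _ ≤ n * 1 := Nat.mul_le_mul h1 h2
      _ = n := mul_one n
  have hQM : ∀ s ∈ Set.Icc (-1 : ℝ) 1, |Q.eval s| ≤ M ^ 2 := by
    intro s hs
    have hy : 1 / 2 - 1 / 2 * s ∈ Set.Icc (0 : ℝ) 1 := ⟨by linarith [hs.2], by linarith [hs.1]⟩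
    have h1 := hBy _ hy
    have h2 := mul_nonneg hy.1 (sq_nonneg (B.eval (1 / 2 - 1 / 2 * s)))
    simp only [Q, eval_sub, eval_mul, eval_C, eval_comp, eval_X, eval_pow]
    rw [abs_le]
    constructor <;> linarith
  have hd := abs_eval_iterate_derivative_le (k := 1) hQdeg hQM le_rfl
  have hT : (derivative (T ℝ n)).eval 1 = (n : ℝ) ^ 2 := by
    rw [T_derivative_eq_U]
    simp [sq]
  have hQ1 : (derivative Q).eval 1 = P.coeff 1 ^ 2 := by
    have hBc : B.coeff 0 = P.coeff 1 := by
      rw [hB, coeff_contract two_ne_zero, coeff_divX]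
    simp only [Q, derivative_sub, derivative_C, derivative_mul, derivative_comp, derivative_X,
      derivative_pow]
    simp [← coeff_zero_eq_eval_zero, hBc]
  simp only [Function.iterate_one] at hd
  rw [hT, hQ1, abs_of_nonneg (sq_nonneg _), ← mul_pow, mul_comm M] at hd
  exact abs_le_of_sq_le_sq hd (by positivity)

end Polynomial

/-! ### Gradients of polynomials on concentric balls -/

namespace MvPolynomial

variable {ι : Type*}

/-- The restriction `s ↦ p (a + s v)` of `p` to the line through `a` with direction `v`, as a
polynomial in one variable. -/
noncomputable def lineRestrict (p : MvPolynomial ι ℝ) (a v : ι → ℝ) : Polynomial ℝ :=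
  aeval (fun i => Polynomial.C (a i) + Polynomial.C (v i) * Polynomial.X) p

theorem natDegree_lineRestrict_le {p : MvPolynomial ι ℝ} {m : ℕ} (hp : p.totalDegree ≤ m)
    (a v : ι → ℝ) : (lineRestrict p a v).natDegree ≤ m := by
  refine (aeval_natDegree_le p hp _ (n := 1) fun i => ?_).trans (mul_one m).le
  compute_degree

theorem eval_lineRestrict (p : MvPolynomial ι ℝ) (a v : ι → ℝ) (s : ℝ) :
    (lineRestrict p a v).eval s = eval (fun i => a i + s * v i) p := by
  unfold lineRestrict
  induction p using MvPolynomial.induction_on with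
  | C c => simp
  | add p q hp hq => simp [hp, hq]
  | mul_X p i hp => simp [hp, mul_comm s]

variable [Fintype ι]

theorem differentiable_eval (p : MvPolynomial ι ℝ) :
    Differentiable ℝ (fun J : EuclideanSpace ℝ ι => eval (fun a => J a) p) := by
  have h := AnalyticOnNhd.eval_continuousLinearMap' (𝕜 := ℝ) (E := EuclideanSpace ℝ ι)
    (fun i => EuclideanSpace.proj i) p
  intro J
  exact (h J (Set.mem_univ _)).differentiableAt

/-- Growth of a polynomial from a ball to a larger concentric one: Chebyshev's estimate on the line
through the centre. -/
theorem abs_eval_le_of_mem_closedBall {p : MvPolynomial ι ℝ} {m : ℕ} (hm : m ≠ 0)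
    (hp : p.totalDegree ≤ m) {x : EuclideanSpace ℝ ι} {r R M : ℝ} (hr : 0 < r) (hrR : r ≤ R)
    (hM : ∀ J ∈ Metric.closedBall x r, |eval (fun a => J a) p| ≤ M)
    {I : EuclideanSpace ℝ ι} (hI : I ∈ Metric.closedBall x R) :
    |eval (fun a => I a) p| ≤ (2 * R / r) ^ m / 2 * M := by
  have hM0 : 0 ≤ M := (abs_nonneg _).trans (hM x (Metric.mem_closedBall_self hr.le))
  rw [Metric.mem_closedBall, dist_eq_norm] at hI
  rcases le_or_gt ‖I - x‖ r with h | h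
  · refine (hM I (by rwa [Metric.mem_closedBall, dist_eq_norm])).trans ?_
    have h2 : (2 : ℝ) ≤ 2 * R / r := by rw [le_div_iff₀ hr]; linarith
    have h3 : (2 : ℝ) * R / r ≤ (2 * R / r) ^ m := le_self_pow₀ (by linarith) hm
    nlinarith
  · set ρ := ‖I - x‖
    have hρ : 0 < ρ := hr.trans h
    have key := Polynomial.abs_eval_le_of_one_le hm
      (natDegree_lineRestrict_le hp (fun i => x i) (fun i => r / ρ * (I - x) i)) (M := M)
      (x := ρ / r) ?_ ((one_le_div hr).mpr h.le)
    · rw [eval_lineRestrict] at key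
      have e : (fun i => x i + ρ / r * (r / ρ * (I - x) i)) = fun i => I i := by
        ext i
        simp only [PiLp.sub_apply]
        field_simp
        ring
      rw [e] at key
      refine key.trans ?_
      gcongr
      rw [mul_div_assoc]
      gcongr
    · intro s hs
      rw [eval_lineRestrict]
      have := hM (x + s • (r / ρ) • (I - x)) ?_
      · simpa using this
      · rw [Metric.mem_closedBall, dist_eq_norm, add_sub_cancel_left, norm_smul, norm_smul,
          Real.norm_eq_abs, Real.norm_eq_abs, abs_of_pos (div_pos hr hρ), div_mul_cancel₀ _ hρ.ne']
        exact mul_le_of_le_one_left hr.le (abs_le.mpr hs)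

/-- Bernstein's inequality on the chords of a ball that are centred at its midpoint. -/
theorem norm_fderiv_eval_le {p : MvPolynomial ι ℝ} {m : ℕ} (hp : p.totalDegree ≤ m)
    {I : EuclideanSpace ℝ ι} {h S : ℝ} (hh : 0 < h)
    (hS : ∀ J ∈ Metric.closedBall I h, |eval (fun a => J a) p| ≤ S) :
    ‖fderiv ℝ (fun J : EuclideanSpace ℝ ι => eval (fun a => J a) p) I‖ ≤ m * S / h := by
  have hS0 : 0 ≤ S := (abs_nonneg _).trans (hS I (Metric.mem_closedBall_self hh.le))
  refine ContinuousLinearMap.opNorm_le_bound _ (by positivity) fun v => ?_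
  rcases eq_or_ne v 0 with rfl | hv
  · simp
  have hv' : 0 < ‖v‖ := norm_pos_iff.mpr hv
  set u := (h / ‖v‖) • v with hu
  have hun : ‖u‖ = h := by
    rw [hu, norm_smul, Real.norm_eq_abs, abs_of_pos (div_pos hh hv'), div_mul_cancel₀ _ hv'.ne']
  have hvu : v = (‖v‖ / h) • u := by
    rw [hu, smul_smul, div_mul_div_cancel₀ hh.ne', div_self hv'.ne', one_smul]
  set q := lineRestrict p (fun i => I i) (fun i => u i) with hq
  have hqe : ∀ s, q.eval s = eval (fun a => (I + s • u) a) p := by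
    intro s; rw [hq, eval_lineRestrict]; simp
  have hb := Polynomial.abs_coeff_one_le (natDegree_lineRestrict_le hp (fun i => I i) (fun i => u i))
    (M := S) (by
      intro s hs
      rw [hqe]
      apply hS
      rw [Metric.mem_closedBall, dist_eq_norm, add_sub_cancel_left, norm_smul, hun,
        Real.norm_eq_abs]
      exact mul_le_of_le_one_left hh.le (abs_le.mpr hs))
  have hd : fderiv ℝ (fun J : EuclideanSpace ℝ ι => eval (fun a => J a) p) I u = q.coeff 1 := by
    have h1 : HasDerivAt (fun s : ℝ => I + s • u) u 0 := by
      simpa using ((hasDerivAt_id (0 : ℝ)).smul_const u).const_add I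
    have h2 := (p.differentiable_eval (I + (0 : ℝ) • u)).hasFDerivAt.comp_hasDerivAt (0 : ℝ) h1
    have h3 := q.hasDerivAt 0
    simp_rw [hqe] at h3
    have := h2.unique h3
    rw [zero_smul, add_zero] at this
    rw [this, ← Polynomial.coeff_zero_eq_eval_zero, Polynomial.coeff_derivative]
    simp
  rw [hvu, map_smul, hd, norm_smul, norm_smul, hun, Real.norm_eq_abs, Real.norm_eq_abs,
    abs_of_pos (div_pos hv' hh), mul_comm]
  calc _ ≤ (m * S) * (‖v‖ / h) := by gcongr
    _ = _ := by field_simp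

/-- A bound for `p` on the ball of radius `r` controls its gradient on the ball of radius `R`. Around
each point of the larger ball there is room for chords of half length `R / m` inside the ball of
radius `R (1 + 1 / m)`, and this enlargement costs only `(1 + 1 / m) ^ m ≤ e` in the growth
estimate. -/
theorem norm_gradient_eval_le {p : MvPolynomial ι ℝ} {m : ℕ}
    (hp : p.totalDegree ≤ m) {x : EuclideanSpace ℝ ι} {r R M : ℝ} (hr : 0 < r) (hrR : r ≤ R)
    (hM : ∀ J ∈ Metric.closedBall x r, |eval (fun a => J a) p| ≤ M)
    {I : EuclideanSpace ℝ ι} (hI : I ∈ Metric.closedBall x R) :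
    ‖gradient (fun J : EuclideanSpace ℝ ι => eval (fun a => J a) p) I‖ ≤
      2 * (m : ℝ) ^ 2 / R * (2 * R / r) ^ m * M := by
  have hR : 0 < R := hr.trans_le hrR
  have hM0 : 0 ≤ M := (abs_nonneg _).trans (hM x (Metric.mem_closedBall_self hr.le))
  rw [gradient, LinearIsometryEquiv.norm_map]
  rcases eq_or_ne m 0 with rfl | hm
  · have hc : p = C (coeff 0 p) := totalDegree_eq_zero_iff_eq_C.mp (Nat.le_zero.mp hp)
    rw [hc]
    simp
  have hm' : (0 : ℝ) < m := by positivity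
  set R' := R * (1 + 1 / m)
  have hRR' : R ≤ R' := le_mul_of_one_le_right hR.le (by simp)
  have hb := norm_fderiv_eval_le hp (I := I) (h := R / m) (S := (2 * R' / r) ^ m / 2 * M)
    (by positivity) (fun J hJ => abs_eval_le_of_mem_closedBall hm hp hr (hrR.trans hRR') hM (by
      rw [Metric.mem_closedBall] at hI hJ ⊢
      calc dist J x ≤ dist J I + dist I x := dist_triangle _ _ _
        _ ≤ R / m + R := add_le_add hJ hI
        _ = R' := by simp only [R']; ring))
  refine hb.trans ?_
  have he : (1 + 1 / (m : ℝ)) ^ m ≤ 4 := by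
    calc (1 + 1 / (m : ℝ)) ^ m ≤ Real.exp (1 / m) ^ m := by
          gcongr; rw [add_comm]; exact Real.add_one_le_exp _
      _ = Real.exp 1 := by rw [← Real.exp_nat_mul]; congr 1; field_simp
      _ ≤ 4 := by linarith [Real.exp_one_lt_d9]
  have e : 2 * R' / r = 2 * R / r * (1 + 1 / m) := by simp only [R']; ring
  rw [e, mul_pow]
  calc m * ((2 * R / r) ^ m * (1 + 1 / (m : ℝ)) ^ m / 2 * M) / (R / m)
      ≤ m * ((2 * R / r) ^ m * 4 / 2 * M) / (R / m) := by gcongr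
    _ = _ := by field_simp; ring

end MvPolynomial

/-! ### Exponential decay of likelihood ratios -/

/-- The Hellinger affinity `∫ √(p q)` of two distinct probability measures with densities `p`, `q` is
less than one: equality in `√(p q) ≤ (p + q) / 2` forces `p = q`. -/
theorem lintegral_sqrt_div_withDensity_lt_one {E : Type*} [MeasurableSpace E] {ν : Measure E}
    {p q : E → ℝ} (hp : Measurable p) (hq : Measurable q) (hp0 : ∀ x, 0 ≤ p x)
    (hq0 : ∀ x, 0 ≤ q x) (hp1 : ∫⁻ x, ENNReal.ofReal (p x) ∂ν = 1)
    (hq1 : ∫⁻ x, ENNReal.ofReal (q x) ∂ν = 1)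
    (hne : ν.withDensity (fun x => ENNReal.ofReal (p x)) ≠
      ν.withDensity (fun x => ENNReal.ofReal (q x))) :
    ∫⁻ x, ENNReal.ofReal (√(q x / p x)) ∂(ν.withDensity fun x => ENNReal.ofReal (p x)) < 1 := by
  have hmean : ∫⁻ x, ENNReal.ofReal ((p x + q x) / 2) ∂ν = 1 := by
    have : ∀ x, ENNReal.ofReal ((p x + q x) / 2) =
        ENNReal.ofReal 2⁻¹ * (ENNReal.ofReal (p x) + ENNReal.ofReal (q x)) := fun x => by
      rw [← ENNReal.ofReal_add (hp0 x) (hq0 x), ← ENNReal.ofReal_mul (by norm_num),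
        div_eq_inv_mul]
    simp_rw [this]
    rw [lintegral_const_mul _ (by fun_prop), lintegral_add_left (by fun_prop), hp1, hq1,
      ENNReal.ofReal_inv_of_pos two_pos, one_add_one_eq_two]
    simp [ENNReal.inv_mul_cancel]
  rw [lintegral_withDensity_eq_lintegral_mul _ (by fun_prop) (by fun_prop)]
  have hpt : ∀ x, ((fun x => ENNReal.ofReal (p x)) * fun x => ENNReal.ofReal (√(q x / p x))) x =
      ENNReal.ofReal (√(p x) * √(q x)) := fun x => by
    rw [Pi.mul_apply, ← ENNReal.ofReal_mul (hp0 x), Real.sqrt_div' _ (hp0 x), mul_div_left_comm,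
      Real.div_sqrt, mul_comm]
  simp_rw [hpt]
  have hle : ∀ x, √(p x) * √(q x) ≤ (p x + q x) / 2 := fun x => by
    nlinarith [sq_nonneg (√(p x) - √(q x)), Real.sq_sqrt (hp0 x), Real.sq_sqrt (hq0 x)]
  have hle' : ∫⁻ x, ENNReal.ofReal (√(p x) * √(q x)) ∂ν ≤ 1 :=
    hmean ▸ lintegral_mono fun x => ENNReal.ofReal_le_ofReal (hle x)
  refine lt_of_le_of_ne hle' fun heq => hne ?_
  have hae := ae_eq_of_ae_le_of_lintegral_le
    (Filter.Eventually.of_forall fun x => ENNReal.ofReal_le_ofReal (hle x))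
    (by rw [heq]; exact ENNReal.one_ne_top) (by fun_prop) (by rw [hmean, heq])
  refine withDensity_congr_ae ?_
  filter_upwards [hae] with x hx
  rw [ENNReal.ofReal_eq_ofReal_iff (by positivity) (by linarith [hp0 x, hq0 x])] at hx
  have h : (√(p x) - √(q x)) ^ 2 = 0 := by
    nlinarith [Real.sq_sqrt (hp0 x), Real.sq_sqrt (hq0 x)]
  have h' : √(p x) = √(q x) := sub_eq_zero.mp (pow_eq_zero_iff two_ne_zero |>.mp h)
  rw [(Real.sqrt_inj (hp0 x) (hq0 x)).mp h']

/-- Likelihood ratios of i.i.d. samples decay exponentially. For a constant `c` between the Hellinger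
affinity `θ` and `1`, the expectation of `∏ j < N, √(q / p)(Z j) / c` is `(θ / c) ^ N`, which is
summable, so these products almost surely tend to zero. In contrast with the law of large numbers
for `log (q / p)`, this needs no integrability of the log-likelihood ratio. -/
theorem exists_eventually_prod_div_le_exp {Ω E : Type*} [MeasurableSpace Ω] [MeasurableSpace E]
    {μ : Measure Ω} {Z : ℕ → Ω → E} (hZm : ∀ j, Measurable (Z j)) (hZi : iIndepFun Z μ)
    {ν : Measure E} {p q : E → ℝ} (hp : Measurable p) (hq : Measurable q) (hp0 : ∀ x, 0 ≤ p x)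
    (hq0 : ∀ x, 0 ≤ q x) (hp1 : ∫⁻ x, ENNReal.ofReal (p x) ∂ν = 1)
    (hq1 : ∫⁻ x, ENNReal.ofReal (q x) ∂ν = 1)
    (hZl : ∀ j, Measure.map (Z j) μ = ν.withDensity (fun x => ENNReal.ofReal (p x)))
    (hne : ν.withDensity (fun x => ENNReal.ofReal (p x)) ≠
      ν.withDensity (fun x => ENNReal.ofReal (q x))) :
    ∃ α : ℝ, 0 < α ∧ ∀ᵐ ω ∂μ, ∀ᶠ N : ℕ in Filter.atTop,
      ∏ j : Fin N, q (Z j ω) / p (Z j ω) ≤ Real.exp (-α * N) := by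
  set h : E → ENNReal := fun x => ENNReal.ofReal (√(q x / p x)) with hh
  have hhm : Measurable h := by fun_prop
  set θ := ∫⁻ x, h x ∂(ν.withDensity fun x => ENNReal.ofReal (p x)) with hθ
  have hθ1 : θ < 1 := lintegral_sqrt_div_withDensity_lt_one hp hq hp0 hq0 hp1 hq1 hne
  obtain ⟨c, hθc, hc1⟩ := exists_between hθ1
  have hc0 : c ≠ 0 := (bot_le.trans_lt hθc).ne'
  have hct : c ≠ ⊤ := (hc1.trans ENNReal.one_lt_top).ne
  have hcr0 : 0 < c.toReal := ENNReal.toReal_pos hc0 hct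
  have hcr1 : c.toReal < 1 := by
    simpa using (ENNReal.toReal_lt_toReal hct ENNReal.one_ne_top).mpr hc1
  refine ⟨-2 * Real.log c.toReal, by nlinarith [Real.log_neg hcr0 hcr1], ?_⟩
  have hint : ∀ N : ℕ, ∫⁻ ω, ∏ j ∈ Finset.range N, h (Z j ω) / c ∂μ = (θ / c) ^ N := by
    intro N
    rw [lintegral_prod_eq_prod_lintegral_of_indepFun _ (fun j ω => h (Z j ω) / c)
      (hZi.comp (fun _ x => h x / c) fun _ => by fun_prop)
      (fun j => (hhm.comp (hZm j)).div_const c)]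
    rw [Finset.prod_eq_pow_card (b := θ / c), Finset.card_range]
    intro j _
    rw [← lintegral_map (f := fun x => h x / c) (by fun_prop) (hZm j), hZl]
    simp_rw [div_eq_mul_inv]
    rw [lintegral_mul_const _ hhm]
  have hmeas : ∀ N : ℕ, Measurable fun ω => ∏ j ∈ Finset.range N, h (Z j ω) / c := fun N =>
    Finset.measurable_fun_prod _ fun j _ => (hhm.comp (hZm j)).div_const c
  have hsum : ∫⁻ ω, ∑' N : ℕ, ∏ j ∈ Finset.range N, h (Z j ω) / c ∂μ ≠ ⊤ := by
    rw [lintegral_tsum fun N => (hmeas N).aemeasurable]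
    simp_rw [hint]
    rw [ENNReal.tsum_geometric]
    refine ENNReal.inv_ne_top.mpr (tsub_pos_of_lt ?_).ne'
    rwa [ENNReal.div_lt_iff (Or.inl hc0) (Or.inl hct), one_mul]
  filter_upwards [ae_lt_top (Measurable.tsum hmeas) hsum] with ω hω
  have ht := ENNReal.tendsto_atTop_zero_of_tsum_ne_top hω.ne
  filter_upwards [ht.eventually_le_const zero_lt_one] with N hN
  have e : ∏ j ∈ Finset.range N, h (Z j ω) / c =
      ENNReal.ofReal (∏ j ∈ Finset.range N, √(q (Z j ω) / p (Z j ω)) / c.toReal) := by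
    rw [ENNReal.ofReal_prod_of_nonneg fun _ _ => by positivity]
    refine Finset.prod_congr rfl fun j _ => ?_
    rw [ENNReal.ofReal_div_of_pos hcr0, ENNReal.ofReal_toReal hct]
  rw [e, ENNReal.ofReal_le_one, Finset.prod_div_distrib, Finset.prod_const, Finset.card_range,
    div_le_one (by positivity)] at hN
  rw [Fin.prod_univ_eq_prod_range (fun j => q (Z j ω) / p (Z j ω)) N]
  calc ∏ j ∈ Finset.range N, q (Z j ω) / p (Z j ω)
      = (∏ j ∈ Finset.range N, √(q (Z j ω) / p (Z j ω))) ^ 2 := by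
        rw [← Finset.prod_pow]
        exact Finset.prod_congr rfl fun j _ =>
          (Real.sq_sqrt (div_nonneg (hq0 _) (hp0 _))).symm
    _ ≤ (c.toReal ^ N) ^ 2 := by
        gcongr
    _ = Real.exp (-(-2 * Real.log c.toReal) * N) := by
        rw [show -(-2 * Real.log c.toReal) * N = ((N * 2 : ℕ) : ℝ) * Real.log c.toReal by
          push_cast; ring, Real.exp_nat_mul, Real.exp_log hcr0, pow_mul]

namespace LatentTaskModel

variable {T X Y Ω : Type*} [Fintype T] [MeasurableSpace X] [MeasurableSpace Y] {d : ℕ}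

theorem pXY_nonneg (M : LatentTaskModel T X Y d) (t : T) (z : X × Y) : 0 ≤ M.pXY t z :=
  mul_nonneg (M.pX_nonneg _ _) (M.pY_nonneg _ _ _)

theorem measurable_pXY (M : LatentTaskModel T X Y d) (t : T) : Measurable (M.pXY t) :=
  ((M.pX_measurable t).comp measurable_fst).mul (M.pY_measurable t)

theorem lintegral_pXY [Countable Y] [MeasurableSingletonClass Y] (M : LatentTaskModel T X Y d) (t : T) :
    ∫⁻ z, ENNReal.ofReal (M.pXY t z) ∂(M.refX.prod Measure.count) = 1 := by
  have := M.refX_sigmaFinite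
  rw [lintegral_prod _ (M.measurable_pXY t).ennreal_ofReal.aemeasurable, ← M.pX_lintegral t]
  refine lintegral_congr fun x => ?_
  simp_rw [pXY, ENNReal.ofReal_mul (M.pX_nonneg t x)]
  rw [lintegral_count, ENNReal.tsum_mul_left,
    ← ENNReal.ofReal_tsum_of_nonneg (M.pY_nonneg t x) (M.pY_hasSum t x).summable,
    (M.pY_hasSum t x).tsum_eq]
  simp

theorem jointLaw_injective [Countable Y] [MeasurableSingletonClass Y]
    {M : LatentTaskModel T X Y d} (hid : M.Identifiable) :
    Function.Injective M.jointLaw := by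
  intro s t h
  by_contra hst
  have hfin : IsFiniteMeasure (M.jointLaw t) := by
    refine ⟨?_⟩
    rw [jointLaw, withDensity_apply _ MeasurableSet.univ, Measure.restrict_univ, M.lintegral_pXY]
    exact ENNReal.one_lt_top
  have := hid s t hst
  rw [h, InformationTheory.klDiv_self] at this
  exact lt_irrefl _ this

variable [MeasurableSpace Ω] {μ : Measure Ω} {Z : ℕ → Ω → X × Y}

/-- One rate `α` serves all wrong tasks, as there are finitely many of them. -/
theorem exists_eventually_prod_pXY_le_exp [Countable Y] [MeasurableSingletonClass Y]
    {M : LatentTaskModel T X Y d} (hid : M.Identifiable)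
    (tstar : T) (hZm : ∀ j, Measurable (Z j)) (hZi : iIndepFun Z μ)
    (hZl : ∀ j, Measure.map (Z j) μ = M.jointLaw tstar) :
    ∃ α : ℝ, 0 < α ∧ ∀ᵐ ω ∂μ, ∀ᶠ N : ℕ in Filter.atTop, ∀ t, t ≠ tstar →
      ∏ j : Fin N, M.pXY t (Z j ω) / M.pXY tstar (Z j ω) ≤ Real.exp (-α * N) := by
  have h : ∀ t : T, ∃ α : ℝ, 0 < α ∧ (t ≠ tstar → ∀ᵐ ω ∂μ, ∀ᶠ N : ℕ in Filter.atTop,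
      ∏ j : Fin N, M.pXY t (Z j ω) / M.pXY tstar (Z j ω) ≤ Real.exp (-α * N)) := by
    intro t
    by_cases ht : t = tstar
    · exact ⟨1, one_pos, fun h => absurd ht h⟩
    · obtain ⟨α, hα, h⟩ := exists_eventually_prod_div_le_exp hZm hZi (M.measurable_pXY tstar)
        (M.measurable_pXY t) (M.pXY_nonneg tstar) (M.pXY_nonneg t) (M.lintegral_pXY tstar)
        (M.lintegral_pXY t) hZl (fun h => ht (jointLaw_injective hid h).symm)
      exact ⟨α, hα, fun _ => h⟩
  choose α hα h using h
  have : Nonempty T := ⟨tstar⟩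
  obtain ⟨t₀, ht₀⟩ := Finite.exists_min α
  refine ⟨α t₀, hα t₀, ?_⟩
  have h' : ∀ᵐ ω ∂μ, ∀ t, t ≠ tstar → ∀ᶠ N : ℕ in Filter.atTop,
      ∏ j : Fin N, M.pXY t (Z j ω) / M.pXY tstar (Z j ω) ≤ Real.exp (-α t * N) := by
    rw [ae_all_iff]
    intro t
    by_cases ht : t = tstar
    · exact Filter.Eventually.of_forall fun ω h => absurd ht h
    · filter_upwards [h t ht] with ω hω _ using hω
  filter_upwards [h'] with ω hω
  rw [Filter.eventually_all]
  intro t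
  by_cases ht : t = tstar
  · exact Filter.Eventually.of_forall fun ω h => absurd ht h
  · filter_upwards [hω t ht] with N hN _
    refine hN.trans (Real.exp_le_exp.mpr ?_)
    have := mul_le_mul_of_nonneg_right (ht₀ t) (Nat.cast_nonneg (α := ℝ) N)
    linarith

/-- Almost surely no likelihood ratio against the true task has a vanishing denominator. -/
theorem ae_forall_pXY_pos {M : LatentTaskModel T X Y d} {tstar : T}
    (hZm : ∀ j, Measurable (Z j)) (hZl : ∀ j, Measure.map (Z j) μ = M.jointLaw tstar) :
    ∀ᵐ ω ∂μ, ∀ j, 0 < M.pXY tstar (Z j ω) := by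
  rw [ae_all_iff]
  intro j
  have h : ∀ᵐ z ∂(M.jointLaw tstar), 0 < M.pXY tstar z := by
    rw [jointLaw, ae_withDensity_iff (M.measurable_pXY tstar).ennreal_ofReal]
    exact Filter.Eventually.of_forall fun z hz => by
      simpa [ENNReal.ofReal_eq_zero] using hz
  rw [← hZl j] at h
  exact ae_of_ae_map (hZm j).aemeasurable h

end LatentTaskModel

/-! ### Regularity and concentration of the posterior predictive -/

namespace InstrSeq

variable {N d : ℕ}

theorem differentiable_block (j : Fin N) :
    Differentiable ℝ (fun I : InstrSeq N d => I.block j) := by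
  rw [differentiable_euclidean]
  intro a
  simp only [block]
  fun_prop

theorem block_const (i : EuclideanSpace ℝ (Fin d)) (j : Fin N) : (const N i).block j = i := rfl

/-- By Cauchy–Schwarz, the blocks of an instruction sequence move by a total of at most `√N` times the
Euclidean distance. This is the source of the factor `√N` in the exponents below. -/
theorem sum_norm_block_sub_le (I J : InstrSeq N d) :
    ∑ j, ‖I.block j - J.block j‖ ≤ √(N : ℝ) * ‖I - J‖ := by
  have h : ∑ j, ‖I.block j - J.block j‖ ^ 2 = ‖I - J‖ ^ 2 := by
    simp_rw [EuclideanSpace.norm_sq_eq, Fintype.sum_prod_type]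
    rfl
  have h2 := sq_sum_le_card_mul_sum_sq (s := Finset.univ)
    (f := fun j => ‖I.block j - J.block j‖)
  rw [h, Finset.card_univ, Fintype.card_fin] at h2
  refine abs_le_of_sq_le_sq' ?_ (by positivity) |>.2
  rwa [mul_pow, Real.sq_sqrt (Nat.cast_nonneg _)]

end InstrSeq

namespace LatentTaskModel

variable {T X Y : Type*} [Fintype T] [MeasurableSpace X] [MeasurableSpace Y] {d N : ℕ}
  {M : LatentTaskModel T X Y d} {G : ℝ} {tstar : T} {xq : X} {z : ℕ → X × Y}

theorem pX_ratio_nonneg (M : LatentTaskModel T X Y d) (t s : T) (x : X) :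
    0 ≤ M.prior t / M.prior s * (M.pX t x / M.pX s x) :=
  mul_nonneg (div_nonneg (M.prior_pos t).le (M.prior_pos s).le)
    (div_nonneg (M.pX_nonneg t x) (M.pX_nonneg s x))

theorem abs_log_pI_sub_le (hbd : M.BoundedInstruction G) (t : T)
    (i j : EuclideanSpace ℝ (Fin d)) :
    |Real.log (M.pI t i) - Real.log (M.pI t j)| ≤ G * ‖i - j‖ := by
  refine convex_univ.norm_image_sub_le_of_norm_fderiv_le (𝕜 := ℝ) (C := G)
    (f := fun i => Real.log (M.pI t i)) (fun x _ => (hbd t x).2.1) (fun x _ => ?_)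
    (Set.mem_univ j) (Set.mem_univ i)
  have := (hbd t x).2.2
  rwa [gradient, LinearIsometryEquiv.norm_map] at this

theorem pSeq_pos (hbd : M.BoundedInstruction G) (t : T) (I : InstrSeq N d) : 0 < M.pSeq t I :=
  Finset.prod_pos fun _ _ => (hbd t _).1

/-- The logarithm of `p(I | t)` is Lipschitz with constant `G √N`. -/
theorem pSeq_le_exp_mul (hG : 0 < G) (hbd : M.BoundedInstruction G) (t : T)
    (I J : InstrSeq N d) :
    M.pSeq t I ≤ Real.exp (G * √(N : ℝ) * ‖I - J‖) * M.pSeq t J := by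
  rw [← Real.log_le_log_iff (pSeq_pos hbd t I) (mul_pos (Real.exp_pos _) (pSeq_pos hbd t J)),
    Real.log_mul (Real.exp_pos _).ne' (pSeq_pos hbd t J).ne', Real.log_exp, ← sub_le_iff_le_add,
    pSeq, pSeq, Real.log_prod fun j _ => (hbd t _).1.ne', Real.log_prod fun j _ => (hbd t _).1.ne',
    ← Finset.sum_sub_distrib]
  calc _ ≤ ∑ j, G * ‖I.block j - J.block j‖ :=
        Finset.sum_le_sum fun j _ => (le_abs_self _).trans (abs_log_pI_sub_le hbd t _ _)
    _ = G * ∑ j, ‖I.block j - J.block j‖ := Finset.mul_sum .. |>.symm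
    _ ≤ G * (√(N : ℝ) * ‖I - J‖) := by gcongr; exact I.sum_norm_block_sub_le J
    _ = _ := by ring

theorem ratioA_le_exp_mul (hG : 0 < G) (hbd : M.BoundedInstruction G) (t : T)
    (I J : InstrSeq N d) :
    M.ratioA tstar xq t I ≤
      Real.exp (2 * G * √(N : ℝ) * ‖I - J‖) * M.ratioA tstar xq t J := by
  have h1 := pSeq_le_exp_mul hG hbd t I J
  have h2 := pSeq_le_exp_mul hG hbd tstar J I
  rw [norm_sub_rev] at h2
  have p1 := pSeq_pos hbd tstar I
  have p2 := pSeq_pos hbd tstar J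
  set e := Real.exp (G * √(N : ℝ) * ‖I - J‖) with he
  have hee : Real.exp (2 * G * √(N : ℝ) * ‖I - J‖) = e * e := by
    rw [he, ← Real.exp_add]; congr 1; ring
  have h3 : M.pSeq t I / M.pSeq tstar I ≤ e * e * (M.pSeq t J / M.pSeq tstar J) := by
    rw [← mul_div_assoc, div_le_div_iff₀ p1 p2]
    calc _ ≤ (e * M.pSeq t J) * (e * M.pSeq tstar I) := by
          gcongr
          exact mul_nonneg (Real.exp_pos _).le (pSeq_pos hbd t J).le
      _ = _ := by ring
  have h4 := mul_le_mul_of_nonneg_right h3 (M.pX_ratio_nonneg t tstar xq)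
  rw [hee, ratioA, ratioA]
  linarith

theorem ratioA_nonneg (hbd : M.BoundedInstruction G) (t : T) (I : InstrSeq N d) :
    0 ≤ M.ratioA tstar xq t I := by
  rw [ratioA, mul_right_comm]
  exact mul_nonneg (M.pX_ratio_nonneg t tstar xq)
    (div_nonneg (pSeq_pos hbd t I).le (pSeq_pos hbd tstar I).le)

theorem ratioA_le_of_mem_closedBall (hG : 0 < G) (hbd : M.BoundedInstruction G) (t : T) {r : ℝ}
    {I J : InstrSeq N d} (hI : I ∈ Metric.closedBall J r) :
    M.ratioA tstar xq t I ≤ Real.exp (2 * G * √(N : ℝ) * r) * M.ratioA tstar xq t J := by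
  rw [mem_closedBall_iff_norm] at hI
  refine (ratioA_le_exp_mul hG hbd t I J).trans ?_
  have := ratioA_nonneg (tstar := tstar) (xq := xq) hbd t J
  gcongr

theorem bddAbove_ratioA (hG : 0 < G) (hbd : M.BoundedInstruction G) (t : T)
    (J : InstrSeq N d) (r : ℝ) :
    BddAbove ((fun I => M.ratioA tstar xq t I) '' Metric.closedBall J r) := by
  refine ⟨Real.exp (2 * G * √(N : ℝ) * r) * M.ratioA tstar xq t J, ?_⟩
  rintro _ ⟨I, hI, rfl⟩
  exact ratioA_le_of_mem_closedBall hG hbd t hI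

theorem ratioA_le_Amax (hG : 0 < G) (hbd : M.BoundedInstruction G) {t : T} (ht : t ≠ tstar)
    {i : EuclideanSpace ℝ (Fin d)} {r : ℝ} {I : InstrSeq N d}
    (hI : I ∈ Metric.closedBall (InstrSeq.const N i) r) :
    M.ratioA tstar xq t I ≤ M.Amax tstar xq i r N := by
  have hb : BddAbove (Set.range fun I : Metric.closedBall (InstrSeq.const N i) r =>
      M.ratioA tstar xq t I.1) := by
    have := bddAbove_ratioA (tstar := tstar) (xq := xq) hG hbd t (InstrSeq.const N i) r
    rwa [Set.image_eq_range] at this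
  exact (le_ciSup hb ⟨I, hI⟩).trans (le_ciSup (f := fun t : {t : T // t ≠ tstar} =>
    ⨆ I : Metric.closedBall (InstrSeq.const N i) r, M.ratioA tstar xq t.1 I.1)
    (Set.finite_range _).bddAbove ⟨t, ht⟩)

theorem Amax_le_of_correctInstruction (hG : 0 < G) (hbd : M.BoundedInstruction G)
    {i : EuclideanSpace ℝ (Fin d)} (hi : M.CorrectInstruction tstar i) (r : ℝ) (N : ℕ) :
    M.Amax tstar xq i r N ≤
      (∑ t, M.prior t / M.prior tstar * (M.pX t xq / M.pX tstar xq)) *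
        Real.exp (2 * G * √(N : ℝ) * r) := by
  have h0 : 0 ≤ ∑ t, M.prior t / M.prior tstar * (M.pX t xq / M.pX tstar xq) :=
    Finset.sum_nonneg fun t _ => M.pX_ratio_nonneg t tstar xq
  refine Real.iSup_le (fun t => Real.iSup_le (fun I => ?_) (by positivity)) (by positivity)
  refine (ratioA_le_of_mem_closedBall hG hbd t.1 I.2).trans ?_
  rw [mul_comm]
  refine mul_le_mul_of_nonneg_right ?_ (Real.exp_pos _).le
  calc M.ratioA tstar xq t.1 (InstrSeq.const N i)
      ≤ M.prior t.1 / M.prior tstar * (M.pX t.1 xq / M.pX tstar xq) := by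
        rw [ratioA, mul_right_comm]
        refine mul_le_of_le_one_right (M.pX_ratio_nonneg _ _ _)
          (div_le_one_of_le₀ ?_ (pSeq_pos hbd _ _).le)
        refine Finset.prod_le_prod (fun j _ => M.pI_nonneg _ _) fun j _ => ?_
        rw [InstrSeq.block_const]
        exact (hi t.1 t.2).le
    _ ≤ _ := Finset.single_le_sum
        (f := fun t => M.prior t / M.prior tstar * (M.pX t xq / M.pX tstar xq))
        (fun t _ => M.pX_ratio_nonneg t tstar xq) (Finset.mem_univ _)

theorem weight_nonneg (M : LatentTaskModel T X Y d) (z : ℕ → X × Y) (xq : X) (t : T)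
    (I : InstrSeq N d) : 0 ≤ M.weight z xq t I := by
  refine mul_nonneg (mul_nonneg (mul_nonneg (M.prior_pos t).le ?_) (M.pX_nonneg _ _)) ?_
  · exact Finset.prod_nonneg fun j _ => M.pI_nonneg _ _
  · exact Finset.prod_nonneg fun j _ => mul_nonneg (M.pX_nonneg _ _) (M.pY_nonneg _ _ _)

theorem weight_pos (hbd : M.BoundedInstruction G) {t : T} (hxq : 0 < M.pX t xq)
    (hz : ∀ j, 0 < M.pXY t (z j)) (I : InstrSeq N d) : 0 < M.weight z xq t I :=
  mul_pos (mul_pos (mul_pos (M.prior_pos t) (pSeq_pos hbd t I)) hxq)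
    (Finset.prod_pos fun j _ => hz j)

theorem sum_weight_pos (hbd : M.BoundedInstruction G) (hxq : 0 < M.pX tstar xq)
    (hz : ∀ j, 0 < M.pXY tstar (z j)) (I : InstrSeq N d) : 0 < ∑ t, M.weight z xq t I :=
  Finset.sum_pos' (fun t _ => M.weight_nonneg z xq t I)
    ⟨tstar, Finset.mem_univ _, weight_pos hbd hxq hz I⟩

theorem weight_le_exp_mul (hG : 0 < G) (hbd : M.BoundedInstruction G) (t : T)
    (I J : InstrSeq N d) :
    M.weight z xq t I ≤ Real.exp (G * √(N : ℝ) * ‖I - J‖) * M.weight z xq t J := by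
  have h := pSeq_le_exp_mul hG hbd t I J
  have h0 : 0 ≤ M.prior t * M.pX t xq * ∏ j : Fin N, M.pXY t (z j) :=
    mul_nonneg (mul_nonneg (M.prior_pos t).le (M.pX_nonneg _ _))
      (Finset.prod_nonneg fun j _ => mul_nonneg (M.pX_nonneg _ _) (M.pY_nonneg _ _ _))
  have h1 := mul_le_mul_of_nonneg_left h h0
  rw [weight, weight]
  linarith

theorem pY_le_one (M : LatentTaskModel T X Y d) (t : T) (x : X) (y : Y) : M.pY t x y ≤ 1 :=
  le_hasSum (M.pY_hasSum t x) y fun y' _ => M.pY_nonneg t x y'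

theorem predictive_eq (M : LatentTaskModel T X Y d) (z : ℕ → X × Y) (xq : X) (yq : Y)
    (I : InstrSeq N d) :
    M.predictive z xq yq N I =
      (∑ t, M.pY t xq yq * M.weight z xq t I) / ∑ t, M.weight z xq t I := by
  rw [Finset.sum_div]
  exact Finset.sum_congr rfl fun t _ => (mul_div_assoc _ _ _).symm

theorem differentiable_predictive (hbd : M.BoundedInstruction G) (hxq : 0 < M.pX tstar xq)
    (hz : ∀ j, 0 < M.pXY tstar (z j)) (yq : Y) :
    Differentiable ℝ (M.predictive z xq yq N) := by
  have hpI : ∀ t, Differentiable ℝ (M.pI t) := fun t i => by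
    have h := (hbd t i).2.1.exp
    simpa [Real.exp_log (hbd t _).1] using h
  have hw : ∀ t, Differentiable ℝ (fun I : InstrSeq N d => M.weight z xq t I) := fun t => by
    have : Differentiable ℝ (fun I : InstrSeq N d => M.pSeq t I) := by
      have hb : ∀ j, Differentiable ℝ (fun I : InstrSeq N d => M.pI t (I.block j)) :=
        fun j => (hpI t).comp (InstrSeq.differentiable_block j)
      unfold pSeq
      fun_prop
    unfold weight
    fun_prop
  have hnum : Differentiable ℝ (fun I : InstrSeq N d =>
      ∑ t, M.pY t xq yq * M.weight z xq t I) :=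
    Differentiable.fun_sum fun t _ => (hw t).const_mul _
  have hden : Differentiable ℝ (fun I : InstrSeq N d => ∑ t, M.weight z xq t I) :=
    Differentiable.fun_sum fun t _ => hw t
  have e : M.predictive z xq yq N = fun I : InstrSeq N d =>
      (∑ t, M.pY t xq yq * M.weight z xq t I) / ∑ t, M.weight z xq t I :=
    funext fun I => M.predictive_eq z xq yq I
  rw [e]
  intro I
  simp_rw [div_eq_mul_inv]
  exact (hnum I).fun_mul ((hden I).fun_inv (sum_weight_pos hbd hxq hz I).ne')

theorem predictive_le_one (hbd : M.BoundedInstruction G) (hxq : 0 < M.pX tstar xq)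
    (hz : ∀ j, 0 < M.pXY tstar (z j)) (yq : Y) (I : InstrSeq N d) :
    M.predictive z xq yq N I ≤ 1 := by
  rw [predictive_eq, div_le_one (sum_weight_pos hbd hxq hz I)]
  exact Finset.sum_le_sum fun t _ =>
    mul_le_of_le_one_left (M.weight_nonneg _ _ _ _) (M.pY_le_one _ _ _)

/-- The logarithm of the posterior predictive is Lipschitz with constant `2 G √N`, one `G √N` coming from
the numerator and one from the normalization. -/
theorem predictive_le_exp_mul (hG : 0 < G) (hbd : M.BoundedInstruction G)
    (hxq : 0 < M.pX tstar xq) (hz : ∀ j, 0 < M.pXY tstar (z j)) (yq : Y) (I J : InstrSeq N d) :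
    M.predictive z xq yq N I ≤
      Real.exp (2 * (G * √(N : ℝ) * ‖I - J‖)) * M.predictive z xq yq N J := by
  rw [predictive_eq, predictive_eq, two_mul, Real.exp_add, ← mul_div_assoc,
    div_le_div_iff₀ (sum_weight_pos hbd hxq hz I) (sum_weight_pos hbd hxq hz J)]
  set e := Real.exp (G * √(N : ℝ) * ‖I - J‖) with he
  have h1 : ∑ t, M.pY t xq yq * M.weight z xq t I ≤
      e * ∑ t, M.pY t xq yq * M.weight z xq t J := by
    rw [Finset.mul_sum]
    refine Finset.sum_le_sum fun t _ => ?_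
    have := mul_le_mul_of_nonneg_left (weight_le_exp_mul (z := z) (xq := xq) hG hbd t I J)
      (M.pY_nonneg t xq yq)
    linarith
  have h2 : ∑ t, M.weight z xq t J ≤ e * ∑ t, M.weight z xq t I := by
    rw [Finset.mul_sum]
    refine Finset.sum_le_sum fun t _ => ?_
    have := weight_le_exp_mul (z := z) (xq := xq) hG hbd t J I
    rwa [norm_sub_rev] at this
  have h3 : 0 ≤ e * ∑ t, M.pY t xq yq * M.weight z xq t J :=
    mul_nonneg (Real.exp_pos _).le (Finset.sum_nonneg fun t _ =>
      mul_nonneg (M.pY_nonneg _ _ _) (M.weight_nonneg _ _ _ _))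
  calc _ ≤ (e * ∑ t, M.pY t xq yq * M.weight z xq t J) * (e * ∑ t, M.weight z xq t I) :=
        mul_le_mul h1 h2 (sum_weight_pos hbd hxq hz J).le h3
    _ = _ := by ring

/-- A gradient bound that needs no surrogate polynomial. The factor `4` in place of `2` comes from
`exp s - 1 ≤ 2 s` for small `s`. -/
theorem norm_gradient_predictive_le (hG : 0 < G) (hbd : M.BoundedInstruction G)
    (hxq : 0 < M.pX tstar xq) (hz : ∀ j, 0 < M.pXY tstar (z j)) (yq : Y) (I : InstrSeq N d) :
    ‖gradient (M.predictive z xq yq N) I‖ ≤ 4 * (G * √(N : ℝ)) := by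
  rw [gradient, LinearIsometryEquiv.norm_map]
  refine (differentiable_predictive hbd hxq hz yq I).hasFDerivAt.le_of_lip' (by positivity) ?_
  have hsmall : ∀ᶠ J in nhds I, 2 * (G * √(N : ℝ) * ‖J - I‖) ≤ 1 := by
    have : Filter.Tendsto (fun J => 2 * (G * √(N : ℝ) * ‖J - I‖)) (nhds I) (nhds 0) := by
      have h : Continuous (fun J : InstrSeq N d => 2 * (G * √(N : ℝ) * ‖J - I‖)) := by fun_prop
      simpa using h.tendsto I
    exact this.eventually_le_const one_pos
  filter_upwards [hsmall] with J hJ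
  set s := 2 * (G * √(N : ℝ) * ‖J - I‖) with hs
  have hs0 : 0 ≤ s := by positivity
  have h1 := predictive_le_exp_mul hG hbd hxq hz yq J I
  have h2 := predictive_le_exp_mul hG hbd hxq hz yq I J
  rw [norm_sub_rev] at h2
  rw [← hs] at h1 h2
  have he : Real.exp s - 1 ≤ 2 * s := by
    have := Real.abs_exp_sub_one_le (x := s) (by rwa [abs_of_nonneg hs0])
    rw [abs_of_nonneg hs0] at this
    exact (le_abs_self _).trans this
  have he0 : 0 ≤ Real.exp s - 1 := by linarith [Real.add_one_le_exp s]
  have b1 := mul_le_of_le_one_right he0 (predictive_le_one hbd hxq hz yq I)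
  have b2 := mul_le_of_le_one_right he0 (predictive_le_one hbd hxq hz yq J)
  rw [Real.norm_eq_abs, abs_le]
  constructor <;> linarith

theorem abs_predictive_sub_le_sum (hbd : M.BoundedInstruction G) (hxq : 0 < M.pX tstar xq)
    (hz : ∀ j, 0 < M.pXY tstar (z j)) (yq : Y) (I : InstrSeq N d) [DecidableEq T] :
    |M.predictive z xq yq N I - M.pY tstar xq yq| ≤
      ∑ t ∈ Finset.univ.erase tstar, M.weight z xq t I / M.weight z xq tstar I := by
  have hW := sum_weight_pos hbd hxq hz I
  have hws := weight_pos hbd hxq hz I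
  have hle : M.weight z xq tstar I ≤ ∑ t, M.weight z xq t I :=
    Finset.single_le_sum (f := fun t => M.weight z xq t I)
      (fun t _ => M.weight_nonneg z xq t I) (Finset.mem_univ _)
  have e : M.predictive z xq yq N I - M.pY tstar xq yq =
      ∑ t ∈ Finset.univ.erase tstar,
        (M.pY t xq yq - M.pY tstar xq yq) * (M.weight z xq t I / ∑ s, M.weight z xq s I) := by
    rw [Finset.sum_erase _ (by simp)]
    simp_rw [sub_mul]
    rw [Finset.sum_sub_distrib, ← Finset.mul_sum, ← Finset.sum_div, div_self hW.ne', mul_one]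
    rfl
  rw [e]
  refine (Finset.abs_sum_le_sum_abs _ _).trans (Finset.sum_le_sum fun t _ => ?_)
  have hd : |M.pY t xq yq - M.pY tstar xq yq| ≤ 1 := by
    rw [abs_le]
    constructor <;>
      linarith [M.pY_le_one t xq yq, M.pY_le_one tstar xq yq, M.pY_nonneg t xq yq,
        M.pY_nonneg tstar xq yq]
  have hw := M.weight_nonneg z xq t I
  rw [abs_mul, abs_of_nonneg (div_nonneg hw hW.le)]
  calc _ ≤ 1 * (M.weight z xq t I / M.weight z xq tstar I) := by gcongr
    _ = _ := one_mul _

/-- Posterior concentration: if the likelihood ratios of the wrong tasks are at most `c`, then the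
predictive differs from the one under the true task by at most `β(N) c` on the inner ball. -/
theorem abs_predictive_sub_le_beta (hG : 0 < G) (hbd : M.BoundedInstruction G)
    (hxq : 0 < M.pX tstar xq) (hz : ∀ j, 0 < M.pXY tstar (z j)) (yq : Y)
    {i : EuclideanSpace ℝ (Fin d)} {r c : ℝ}
    (hc : ∀ t, t ≠ tstar → ∏ j : Fin N, M.pXY t (z j) / M.pXY tstar (z j) ≤ c)
    {I : InstrSeq N d} (hI : I ∈ Metric.closedBall (InstrSeq.const N i) r) :
    |M.predictive z xq yq N I - M.pY tstar xq yq| ≤ M.beta tstar xq i r N * c := by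
  classical
  refine (abs_predictive_sub_le_sum hbd hxq hz yq I).trans ?_
  have hb : ∀ t ∈ Finset.univ.erase tstar, M.weight z xq t I / M.weight z xq tstar I ≤
      M.Amax tstar xq i r N * c := by
    intro t ht
    have ht := Finset.ne_of_mem_erase ht
    have e : M.weight z xq t I / M.weight z xq tstar I =
        M.ratioA tstar xq t I * ∏ j : Fin N, M.pXY t (z j) / M.pXY tstar (z j) := by
      rw [weight, weight, ratioA, Finset.prod_div_distrib]
      simp only [mul_div_mul_comm]
    rw [e]
    have h1 := ratioA_le_Amax (xq := xq) hG hbd ht hI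
    have h0 := ratioA_nonneg (tstar := tstar) (xq := xq) hbd t I
    exact mul_le_mul h1 (hc t ht) (Finset.prod_nonneg fun j _ => div_nonneg
      (mul_nonneg (M.pX_nonneg _ _) (M.pY_nonneg _ _ _)) (hz j).le) (h0.trans h1)
  refine (Finset.sum_le_card_nsmul _ _ _ hb).trans ?_
  rw [Finset.card_erase_of_mem (Finset.mem_univ _), Finset.card_univ, nsmul_eq_mul,
    Nat.cast_sub (Fintype.card_pos_iff.mpr ⟨tstar⟩), Nat.cast_one, beta, mul_assoc]

end LatentTaskModel

/-! ### The gradient bounds -/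

/-- A function that is nearly constant on the inner ball and has a `C¹` surrogate of degree `n k` on the
outer ball obeys the explicit gradient bound there: `norm_gradient_eval_le` is applied to the
surrogate minus the constant. -/
theorem norm_gradient_le_explicitBound {ι : Type*} [Fintype ι] {f : EuclideanSpace ℝ ι → ℝ}
    {x : EuclideanSpace ℝ ι} {r R b c ε δ : ℝ} {n k : ℕ} {p : MvPolynomial ι ℝ} (hr : 0 < r)
    (hrR : r ≤ R) (hp : IsC1Surrogate f (Metric.closedBall x R) (n * k) ε δ p)
    (hf : ∀ I ∈ Metric.closedBall x r, |f I - c| ≤ b) {I : EuclideanSpace ℝ ι}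
    (hI : I ∈ Metric.closedBall x R) :
    ‖gradient f I‖ ≤ explicitBound r R n k b ε δ := by
  obtain ⟨hdeg, hval, hgrad⟩ := hp
  have hR : 0 < R := hr.trans_le hrR
  have hpc : ∀ J ∈ Metric.closedBall x r,
      |MvPolynomial.eval (fun a => J a) (p - MvPolynomial.C c)| ≤ b + ε := by
    intro J hJ
    rw [map_sub, MvPolynomial.eval_C]
    have h1 := abs_le.mp (hf J hJ)
    have h2 := abs_le.mp (hval J (Metric.closedBall_subset_closedBall hrR hJ))
    rw [abs_le]
    constructor <;> linarith
  have hb := MvPolynomial.norm_gradient_eval_le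
    ((MvPolynomial.totalDegree_sub_C_le p c).trans hdeg) hr hrR hpc hI
  have e : gradient (fun J : EuclideanSpace ℝ ι =>
      MvPolynomial.eval (fun a => J a) (p - MvPolynomial.C c)) I =
      gradient (fun J : EuclideanSpace ℝ ι => MvPolynomial.eval (fun a => J a) p) I := by
    simp_rw [map_sub, MvPolynomial.eval_C, gradient, fderiv_sub_const]
  rw [e] at hb
  have hpow : Real.exp (Real.log (2 * R / r) * k * n) = (2 * R / r) ^ (n * k) := by
    rw [show Real.log (2 * R / r) * k * n = ((n * k : ℕ) : ℝ) * Real.log (2 * R / r) by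
      push_cast; ring, Real.exp_nat_mul, Real.exp_log (by positivity)]
  have ht := norm_le_norm_add_norm_sub
    (gradient (fun J : EuclideanSpace ℝ ι => MvPolynomial.eval (fun a => J a) p) I)
    (gradient f I)
  rw [norm_sub_rev] at ht
  rw [explicitBound, hpow]
  calc _ ≤ _ := ht
    _ ≤ _ := add_le_add hb (hgrad I hI)
    _ = _ := by push_cast; ring

/-- The explicit bound in terms of `L² = C₁ k n`. -/
theorem explicitBound_eq {r R : ℝ} (hr : 0 < r) (hrR : r < R) (n k : ℕ) (b ε δ : ℝ) {L : ℝ}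
    (hL : L = √(Real.log (2 * R / r) * k * n)) :
    explicitBound r R n k b ε δ =
      2 / (R * Real.log (2 * R / r) ^ 2) * (L ^ 4 * Real.exp (L ^ 2)) * (b + ε) + δ := by
  have hC : 0 < Real.log (2 * R / r) := Real.log_pos (by rw [lt_div_iff₀ hr]; linarith)
  have hL2 : L ^ 2 = Real.log (2 * R / r) * k * n := by rw [hL, Real.sq_sqrt (by positivity)]
  have hL4 : L ^ 4 = (Real.log (2 * R / r) * k * n) ^ 2 := by rw [← hL2]; ring
  have hR : R ≠ 0 := (hr.trans hrR).ne'
  rw [explicitBound, hL2, hL4]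
  field_simp

theorem sqrt_mul_rpow_eq {a G R : ℝ} (hG : 0 ≤ G) (hR : 0 ≤ R) (d N : ℕ) (ha : 0 ≤ a) :
    √a * (G * R * d * (N : ℝ) ^ (3 / 2 : ℝ)) =
      √(a * (N * d) * (G ^ 2 * R ^ 2 * d * (N : ℝ) ^ 2)) := by
  have h3 : ((N : ℝ) ^ (3 / 2 : ℝ)) ^ 2 = (N : ℝ) ^ 3 := by
    rw [← Real.rpow_natCast, ← Real.rpow_mul (Nat.cast_nonneg _)]
    norm_num
  rw [show a * (N * d) * (G ^ 2 * R ^ 2 * d * (N : ℝ) ^ 2) =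
    a * (G * R * d * (N : ℝ) ^ (3 / 2 : ℝ)) ^ 2 by rw [mul_pow, h3]; ring, Real.sqrt_mul ha,
    Real.sqrt_sq (by positivity)]

/-- Half of the decay rate `α` absorbs the growth `exp (2 G √N r)` of `A_max(N)`, at the price of a
constant: `2 G r √N ≤ α N / 2 + 2 (G r)² / α`. -/
theorem LatentTaskModel.beta_mul_exp_le {T X Y : Type*} [Fintype T] [MeasurableSpace X]
    [MeasurableSpace Y] {d : ℕ} {M : LatentTaskModel T X Y d} {tstar : T} {xq : X}
    {i : EuclideanSpace ℝ (Fin d)} {r K G α : ℝ} (hα : 0 < α) (hK : 0 ≤ K) {N : ℕ}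
    (h : M.Amax tstar xq i r N ≤ K * Real.exp (2 * G * √(N : ℝ) * r)) :
    M.beta tstar xq i r N * Real.exp (-α * N) ≤
      Fintype.card T * K * Real.exp (2 * (G * r) ^ 2 / α) * Real.exp (-(α / 2) * N) := by
  have hc : (1 : ℝ) ≤ Fintype.card T := by
    exact_mod_cast Fintype.card_pos_iff.mpr ⟨tstar⟩
  have hexp : 2 * G * √(N : ℝ) * r + -α * N ≤ 2 * (G * r) ^ 2 / α + -(α / 2) * N := by
    have hs : √(N : ℝ) ^ 2 = N := Real.sq_sqrt (Nat.cast_nonneg _)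
    have : 0 ≤ (α * √(N : ℝ) - 2 * (G * r)) ^ 2 / (2 * α) := by positivity
    have e : (α * √(N : ℝ) - 2 * (G * r)) ^ 2 / (2 * α) =
        α / 2 * √(N : ℝ) ^ 2 - 2 * G * √(N : ℝ) * r + 2 * (G * r) ^ 2 / α := by
      field_simp; ring
    rw [e, hs] at this
    linarith
  rw [beta]
  calc _ ≤ (((Fintype.card T : ℝ) - 1) * (K * Real.exp (2 * G * √(N : ℝ) * r))) *
        Real.exp (-α * N) := by
        gcongr
    _ ≤ ((Fintype.card T : ℝ) * (K * Real.exp (2 * G * √(N : ℝ) * r))) * Real.exp (-α * N) := by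
        gcongr
        linarith
    _ = Fintype.card T * K * Real.exp (2 * G * √(N : ℝ) * r + -α * N) := by
        rw [Real.exp_add]; ring
    _ ≤ Fintype.card T * K * Real.exp (2 * (G * r) ^ 2 / α + -(α / 2) * N) := by gcongr
    _ = _ := by rw [Real.exp_add]; ring

theorem mul_div_sqrt_le {c₀ c₁ G R : ℝ} (hc₀ : 0 < c₀) (hc₁ : 0 < c₁) (hG : 0 < G) (hR : 0 < R)
    {d N : ℕ} {x : ℝ} (hx : c₁ * (G ^ 2 * R ^ 2 * d * (N : ℝ) ^ 2) ≤ x) :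
    c₀ * G * R * √(d : ℝ) * (N / √x) ≤ c₀ / √c₁ := by
  have h := Real.sqrt_le_sqrt hx
  rw [show c₁ * (G ^ 2 * R ^ 2 * d * (N : ℝ) ^ 2) = c₁ * ((G * R * N) ^ 2 * d) by ring,
    Real.sqrt_mul hc₁.le, Real.sqrt_mul (by positivity), Real.sqrt_sq (by positivity)] at h
  have hs : 0 < √c₁ := Real.sqrt_pos.mpr hc₁
  rw [← mul_div_assoc]
  refine div_le_of_le_mul₀ (Real.sqrt_nonneg _) (by positivity) ?_
  rw [div_mul_eq_mul_div, le_div_iff₀ hs]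
  calc _ = c₀ * (√c₁ * (G * R * N * √(d : ℝ))) := by ring
    _ ≤ _ := by gcongr

theorem corollary3 {T X Y Ω : Type*} [Fintype T] [MeasurableSpace X]
    [MeasurableSpace Y] [Countable Y] [MeasurableSingletonClass Y]
    {d : ℕ} (M : LatentTaskModel T X Y d)
    -- identifiable tasks, bounded instruction sensitivity
    (hid : M.Identifiable) (G : ℝ) (hG : 0 < G) (hbd : M.BoundedInstruction G)
    -- the true task, the query, and the common centre of the two balls
    (tstar : T) (xq : X) (hxq : 0 < M.pX tstar xq) (yq : Y) (istar : EuclideanSpace ℝ (Fin d))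
    -- the demonstrations: i.i.d. pairs drawn from the true task
    [MeasurableSpace Ω] (μ : Measure Ω) [IsProbabilityMeasure μ] (Z : ℕ → Ω → X × Y)
    (hZm : ∀ j, Measurable (Z j)) (hZi : iIndepFun Z μ)
    (hZl : ∀ j, Measure.map (Z j) μ = M.jointLaw tstar)
    (r R : ℝ) (hr : 0 < r) (hrR : r < R) :
    -- the suprema that define `β(N)` are finite
    (∀ (N : ℕ) (t : T), BddAbove
      ((fun I : InstrSeq N d => M.ratioA tstar xq t I) ''
        Metric.closedBall (InstrSeq.const N istar) r)) ∧
    ∃ α : ℝ, 0 < α ∧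
      -- the explicit gradient bound in terms of a polynomial surrogate
      (∀ᵐ ω ∂μ, ∃ N₀ : ℕ, ∀ N : ℕ, N₀ ≤ N → ∀ n : ℕ, 1 ≤ n → ∀ ε δ : ℝ,
        (∃ p : MvPolynomial (Fin N × Fin d) ℝ,
          IsC1Surrogate (M.predictive (fun j => Z j ω) xq yq N)
            (Metric.closedBall (InstrSeq.const N istar) R) (n * (N * d)) ε δ p) →
        ∀ I ∈ Metric.closedBall (InstrSeq.const N istar) R,
          DifferentiableAt ℝ (M.predictive (fun j => Z j ω) xq yq N) I ∧
          ‖gradient (M.predictive (fun j => Z j ω) xq yq N) I‖ ≤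
            explicitBound r R n (N * d)
              (M.beta tstar xq istar r N * Real.exp (-α * N)) ε δ) ∧
      -- consequences when the repeated instruction is correct for the true task
      (M.CorrectInstruction tstar istar →
        -- `A_max(N) = O(exp(2 G √N r))`
        (∃ K : ℝ, ∀ N : ℕ, M.Amax tstar xq istar r N ≤ K * Real.exp (2 * G * √(N : ℝ) * r)) ∧
        -- the choice `n = Θ(G² R² d N²)`
        (∀ c₀ c₁ c₂ : ℝ, 0 < c₀ → 0 < c₁ → c₁ ≤ c₂ →
          ∃ α' β' ε' : ℝ, 0 < α' ∧ 0 < β' ∧ 0 < ε' ∧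
            ∀ᵐ ω ∂μ, ∃ N₀ : ℕ, ∀ N : ℕ, N₀ ≤ N → ∀ n : ℕ,
              c₁ * (G ^ 2 * R ^ 2 * d * (N : ℝ) ^ 2) ≤ n →
              (n : ℝ) ≤ c₂ * (G ^ 2 * R ^ 2 * d * (N : ℝ) ^ 2) →
              ∀ L : ℝ, L = √(Real.log (2 * R / r) * (N * d : ℕ) * n) →
              -- `L = Θ(G R d N^{3/2})`
              (√(Real.log (2 * R / r) * c₁) * (G * R * d * (N : ℝ) ^ (3 / 2 : ℝ)) ≤ L ∧
                L ≤ √(Real.log (2 * R / r) * c₂) * (G * R * d * (N : ℝ) ^ (3 / 2 : ℝ))) ∧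
              -- the explicit bound is of order `L⁴ exp(L²) (β' exp(-α' N) + ε')`
              (∀ ε δ : ℝ, ε ≤ c₀ * G * R * √(d : ℝ) * (N / √(n : ℝ)) →
                explicitBound r R n (N * d)
                    (M.beta tstar xq istar r N * Real.exp (-α * N)) ε δ ≤
                  2 / (R * Real.log (2 * R / r) ^ 2) * (L ^ 4 * Real.exp (L ^ 2)) *
                    (β' * Real.exp (-α' * N) + ε') + δ) ∧
              -- and the gradient itself satisfies a bound of that order
              (∀ I ∈ Metric.closedBall (InstrSeq.const N istar) R,
                DifferentiableAt ℝ (M.predictive (fun j => Z j ω) xq yq N) I ∧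
                ‖gradient (M.predictive (fun j => Z j ω) xq yq N) I‖ ≤
                  2 / (R * Real.log (2 * R / r) ^ 2) * (L ^ 4 * Real.exp (L ^ 2)) *
                    (β' * Real.exp (-α' * N) + ε')))) := by

  have hR : 0 < R := hr.trans hrR
  have hC : 0 < Real.log (2 * R / r) := Real.log_pos (by rw [lt_div_iff₀ hr]; linarith)
  have hpos := LatentTaskModel.ae_forall_pXY_pos (M := M) hZm hZl
  obtain ⟨α, hα, hconc⟩ :=
    LatentTaskModel.exists_eventually_prod_pXY_le_exp hid tstar hZm hZi hZl
  refine ⟨fun N t => LatentTaskModel.bddAbove_ratioA hG hbd t _ r, α, hα, ?_, fun hi => ⟨?_, ?_⟩⟩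
  · filter_upwards [hpos, hconc] with ω hz hω
    obtain ⟨N₀, hN₀⟩ := Filter.eventually_atTop.mp hω
    refine ⟨N₀, fun N hN n _ ε δ ⟨p, hp⟩ I hI => ⟨?_, ?_⟩⟩
    · exact LatentTaskModel.differentiable_predictive hbd hxq hz yq I
    · exact norm_gradient_le_explicitBound hr hrR.le hp (fun J hJ =>
        LatentTaskModel.abs_predictive_sub_le_beta hG hbd hxq hz yq (hN₀ N hN) hJ) hI
  · exact ⟨_, fun N => LatentTaskModel.Amax_le_of_correctInstruction hG hbd hi r N⟩
  · intro c₀ c₁ c₂ hc₀ hc₁ _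
    set K := ∑ t, M.prior t / M.prior tstar * (M.pX t xq / M.pX tstar xq)
    have hK : 0 ≤ K := Finset.sum_nonneg fun t _ => M.pX_ratio_nonneg t tstar xq
    set β' := Fintype.card T * K * Real.exp (2 * (G * r) ^ 2 / α) + 1
    have hβ' : 0 < β' := by positivity
    set ε' := c₀ / √c₁
    have hε' : 0 < ε' := div_pos hc₀ (Real.sqrt_pos.mpr hc₁)
    refine ⟨α / 2, β', ε', by positivity, hβ', hε', ?_⟩
    filter_upwards [hpos] with ω hz
    -- from this index on, `4 G N ≤ 2 N² ε' / R`
    obtain ⟨N₀, hN₀⟩ := exists_nat_ge (2 * G * R / ε')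
    refine ⟨max N₀ 1, fun N hN n hn₁ hn₂ L hL => ⟨⟨?_, ?_⟩, ?_, ?_⟩⟩
    · rw [sqrt_mul_rpow_eq hG.le hR.le d N (by positivity), hL]
      apply Real.sqrt_le_sqrt
      push_cast
      calc _ = Real.log (2 * R / r) * (N * d) * (c₁ * (G ^ 2 * R ^ 2 * d * (N : ℝ) ^ 2)) := by ring
        _ ≤ _ := by gcongr
    · have hc₂ : 0 ≤ c₂ := by linarith
      rw [sqrt_mul_rpow_eq hG.le hR.le d N (by positivity), hL]
      apply Real.sqrt_le_sqrt
      push_cast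
      calc _ ≤ Real.log (2 * R / r) * (N * d) * (c₂ * (G ^ 2 * R ^ 2 * d * (N : ℝ) ^ 2)) := by
            gcongr
        _ = _ := by ring
    -- the explicit bound, with a surrogate error of at most `ε'`
    · intro ε δ hε
      rw [explicitBound_eq hr hrR n (N * d) _ ε δ hL]
      have h1 : M.beta tstar xq istar r N * Real.exp (-α * N) ≤
          β' * Real.exp (-(α / 2) * N) :=
        (LatentTaskModel.beta_mul_exp_le hα hK
          (LatentTaskModel.Amax_le_of_correctInstruction hG hbd hi r N)).trans
          (mul_le_mul_of_nonneg_right (lt_add_one _).le (Real.exp_pos _).le)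
      have h2 : ε ≤ ε' := hε.trans (mul_div_sqrt_le hc₀ hc₁ hG hR hn₁)
      have hL0 : 0 ≤ L := hL ▸ Real.sqrt_nonneg _
      gcongr
    -- The gradient itself: without a surrogate at hand it is bounded by `4 G √N`, whereas the factor
    -- `2 n² k² / R` and the term `ε'` alone make the right-hand side at least `2 N² ε' / R`.
    · intro I _
      refine ⟨LatentTaskModel.differentiable_predictive hbd hxq hz yq I, ?_⟩
      have hRHS := explicitBound_eq hr hrR n (N * d) (β' * Real.exp (-(α / 2) * N)) ε' 0 hL
      rw [add_zero] at hRHS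
      rw [← hRHS, explicitBound, add_zero]
      -- for `d = 0` the hypotheses force `n = 0`, but then there are no directions to differentiate in
      rcases Nat.eq_zero_or_pos d with rfl | hd
      · rw [Subsingleton.elim (gradient _ I) 0, norm_zero]
        positivity
      · refine (LatentTaskModel.norm_gradient_predictive_le hG hbd hxq hz yq I).trans ?_
        have hN1 : 1 ≤ N := (le_max_right _ _).trans hN
        have hN1' : (1 : ℝ) ≤ N := by exact_mod_cast hN1
        have hN' : 2 * G * R / ε' ≤ N :=
          hN₀.trans (by exact_mod_cast (le_max_left _ _).trans hN)
        have hd' : (0 : ℝ) < d := by exact_mod_cast hd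
        have hn : (1 : ℝ) ≤ n := by
          have : (0 : ℝ) < n := lt_of_lt_of_le (by positivity) hn₁
          exact_mod_cast this
        have hk : (N : ℝ) ≤ (N * d : ℕ) := by
          exact_mod_cast Nat.le_mul_of_pos_right N hd
        have hsN : √(N : ℝ) ≤ N := by
          rw [Real.sqrt_le_left (by positivity)]
          nlinarith
        calc 4 * (G * √(N : ℝ)) ≤ 4 * (G * N) := by gcongr
          _ ≤ 2 * 1 ^ 2 * (N : ℝ) ^ 2 / R * 1 * (0 + ε') := by
              rw [div_le_iff₀ hε'] at hN'
              rw [zero_add, mul_one, one_pow, mul_one, div_mul_eq_mul_div, le_div_iff₀ hR]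
              nlinarith
          _ ≤ _ := by
              gcongr
              · exact Real.one_le_exp (by positivity)
              · positivity
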